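/- **Proposition.** Let $0<b\le\infty$ and let $h:[0,b)\to\mathbb R$ be a smooth function with $h(0)=0$, $h'(0)=1$, $h^{(2k)}(0)=0$ for all $k\ge 1$, and $h>0$ on $(0,b)$. Let $M'^4_h(o')$ be the 4-dimensional model with pole $o'$ whose metric in geodesic polar coordinates $(\theta,\rho)\in \mathbb S^{3}\times[0,b)$ centred at $o'$ is $d\rho^2+h(\rho)^2 g_{\mathbb S^3}$ (for $b=\infty$ this is a complete model; for finite $b$ this includes compact models such as round spheres with the point opposite to the pole removed). Assume that on $(0,b)$ $$h^2h'''+h'(2+h\,h'')-2h'^3=0 .$$ Let $0<R\le\infty$ and let $B_R\subseteq\mathbb R^4$ be the open ball of radius $R$ centred at the origin, with the Euclidean metric ($B_\infty=\mathbb R^4$). Let $\alpha:[0,R)\to[0,b)$ satisfy $\alpha(0)=0$ and be smooth and positive on $(0,R)$, and suppose that the rotationally symmetric map $\varphi_\alpha(\theta,r)=(\theta,\alpha(r))$ is a conformal diffeomorphism from $B_R$ onto an open subset of $M'^4_h(o')$ (possibly all of it). Then $\varphi_\alpha$ is biharmonic on $B_R$ (including at the pole), i.e. its bitension field $$\tau_2(\varphi_\alpha)=-\Delta\,\tau(\varphi_\alpha)-\operatorname{trace}R^{M'}\big(d\varphi_\alpha,\tau(\varphi_\alpha)\big)d\varphi_\alpha$$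 vanishes, where $\tau(\varphi)=\operatorname{trace}\nabla d\varphi$ is the tension field, $\Delta=-\operatorname{trace}\nabla^2$ is the rough Laplacian on sections of $\varphi_\alpha^{-1}(TM')$ and $R^{M'}(X,Y)=\nabla_X\nabla_Y-\nabla_Y\nabla_X-\nabla_{[X,Y]}$. In particular, every rotationally symmetric conformal diffeomorphism $\varphi_\alpha:\mathbb R^4\to M'^4_h(o')$ is biharmonic. -/

import Mathlib

open scoped ContDiff

noncomputable section

namespace BiharmonicModels

/-- The coordinate space `ℝⁿ`. -/
abbrev Coord (n : ℕ) : Type := EuclideanSpace ℝ (Fin n)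

/-- A Riemannian metric in a global coordinate system, given by its components `g i j`. -/
abbrev MetricField (n : ℕ) : Type := Coord n → Matrix (Fin n) (Fin n) ℝ

/-- The partial derivative `∂ F / ∂ xⁱ` at `x`. -/
def pd {n : ℕ} (i : Fin n) (F : Coord n → ℝ) (x : Coord n) : ℝ :=
  fderiv ℝ F x (EuclideanSpace.single i (1 : ℝ))

/-! ### Levi-Civita connection and curvature in coordinates -/

/-- The Christoffel symbol `Γᵏᵢⱼ` of the Levi-Civita connection of `g`:
`Γᵏᵢⱼ = (1/2) ∑ₗ gᵏˡ (∂ᵢ gⱼₗ + ∂ⱼ gᵢₗ - ∂ₗ gᵢⱼ)`. -/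
def christoffel {n : ℕ} (g : MetricField n) (k i j : Fin n) (x : Coord n) : ℝ :=
  (1 / 2) * ∑ l, (g x)⁻¹ k l *
    (pd i (fun y => g y j l) x + pd j (fun y => g y i l) x - pd l (fun y => g y i j) x)

/-- The components of the curvature operator `R(X,Y) = ∇_X ∇_Y - ∇_Y ∇_X - ∇_[X,Y]`:
`R(∂ᵢ,∂ⱼ)∂ₖ = ∑ₗ (curvature g l i j k) ∂ₗ`. -/
def curvature {n : ℕ} (g : MetricField n) (l i j k : Fin n) (x : Coord n) : ℝ :=
  pd i (christoffel g l j k) x - pd j (christoffel g l i k) x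
    + ∑ s, (christoffel g s j k x * christoffel g l i s x
      - christoffel g s i k x * christoffel g l j s x)

/-! ### Tension and bitension field of a map `φ : (M, gM) → (N, gN)` -/

/-- The derivative `∂ φᵃ / ∂ xⁱ`. -/
def dmap {m n : ℕ} (φ : Coord m → Coord n) (a : Fin n) (i : Fin m) (x : Coord m) : ℝ :=
  pd i (fun y => φ y a) x

/-- The `c`-component of the second fundamental form of `φ`, evaluated at `(∂ᵢ, ∂ⱼ)`. -/
def secondFundForm {m n : ℕ} (gM : MetricField m) (gN : MetricField n)
    (φ : Coord m → Coord n) (c : Fin n) (i j : Fin m) (x : Coord m) : ℝ :=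
  pd i (dmap φ c j) x - ∑ k, christoffel gM k i j x * dmap φ c k x
    + ∑ a, ∑ b, christoffel gN c a b (φ x) * dmap φ a i x * dmap φ b j x

/-- The tension field `τ(φ) = trace ∇dφ`, a section of `φ⁻¹(TN)`. -/
def tension {m n : ℕ} (gM : MetricField m) (gN : MetricField n)
    (φ : Coord m → Coord n) (c : Fin n) (x : Coord m) : ℝ :=
  ∑ i, ∑ j, (gM x)⁻¹ i j * secondFundForm gM gN φ c i j x

/-- The covariant derivative `∇ᵢ V` of a section `V` of `φ⁻¹(TN)` for the pulled back
Levi-Civita connection of `gN`. -/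
def pullbackDeriv {m n : ℕ} (gN : MetricField n) (φ : Coord m → Coord n) (i : Fin m)
    (V : Fin n → Coord m → ℝ) (c : Fin n) (x : Coord m) : ℝ :=
  pd i (V c) x + ∑ a, ∑ b, christoffel gN c a b (φ x) * dmap φ a i x * V b x

/-- The rough Laplacian on sections of `φ⁻¹(TN)`, with the sign convention under which it is
nonnegative: `Δ V = - ∑ gᵢⱼ⁻¹ (∇ᵢ ∇ⱼ V - ∑ₖ Γᵏᵢⱼ ∇ₖ V)`. -/
def roughLaplacian {m n : ℕ} (gM : MetricField m) (gN : MetricField n)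
    (φ : Coord m → Coord n) (V : Fin n → Coord m → ℝ) (c : Fin n) (x : Coord m) : ℝ :=
  -∑ i, ∑ j, (gM x)⁻¹ i j *
    (pullbackDeriv gN φ i (pullbackDeriv gN φ j V) c x
      - ∑ k, christoffel gM k i j x * pullbackDeriv gN φ k V c x)

/-- The trace of `R^N(dφ, V)dφ`. -/
def curvatureTrace {m n : ℕ} (gM : MetricField m) (gN : MetricField n)
    (φ : Coord m → Coord n) (V : Fin n → Coord m → ℝ) (d : Fin n) (x : Coord m) : ℝ :=
  ∑ i, ∑ j, (gM x)⁻¹ i j *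
    ∑ a, ∑ b, ∑ c, curvature gN d a b c (φ x) * dmap φ a i x * V b x * dmap φ c j x

/-- The bitension field `τ₂(φ) = - Δ τ(φ) - trace R^N(dφ, τ(φ))dφ`. -/
def bitension {m n : ℕ} (gM : MetricField m) (gN : MetricField n)
    (φ : Coord m → Coord n) (c : Fin n) (x : Coord m) : ℝ :=
  -roughLaplacian gM gN φ (tension gM gN φ) c x
    - curvatureTrace gM gN φ (tension gM gN φ) c x

/-- `φ` is a biharmonic map on the open set `U`. -/
def IsBiharmonicOn {m n : ℕ} (gM : MetricField m) (gN : MetricField n)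
    (φ : Coord m → Coord n) (U : Set (Coord m)) : Prop :=
  ContDiffOn ℝ ∞ φ U ∧ ∀ x ∈ U, ∀ c, bitension gM gN φ c x = 0

/-! ### Conformal diffeomorphisms -/

/-- `φ` restricts to a conformal diffeomorphism from the open set `U`, with metric `gM`, onto the
open set `V`, with metric `gN`. -/
structure IsConformalDiffeo {m n : ℕ} (gM : MetricField m) (gN : MetricField n)
    (φ : Coord m → Coord n) (U : Set (Coord m)) (V : Set (Coord n)) : Prop where
  smooth : ContDiffOn ℝ ∞ φ U
  bijOn : Set.BijOn φ U V
  smooth_inverse : ∃ ψ : Coord n → Coord m, ContDiffOn ℝ ∞ ψ V ∧ Set.InvOn ψ φ U V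
  conformal : ∀ x ∈ U, ∃ dil : ℝ, 0 < dil ∧ ∀ i j,
    ∑ a, ∑ b, gN (φ x) a b * dmap φ a i x * dmap φ b j x = dil ^ 2 * gM x i j

/-! ### Models and rotationally symmetric maps -/

/-- The interval `[0, b)`, where `b = ⊤` is allowed. -/
def radialInterval (b : EReal) : Set ℝ := {t | 0 ≤ t ∧ (t : EReal) < b}

/-- The open ball of radius `b` about the origin; it is all of `ℝⁿ` for `b = ⊤`. -/
def coordBall (n : ℕ) (b : EReal) : Set (Coord n) := {x | ((‖x‖ : ℝ) : EReal) < b}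

/-- The conditions on a function `h` on `[0, b)` that make `dr² + h(r)² g_{S^{n-1}}` the metric of
a model in geodesic polar coordinates about its pole. The complete noncompact models are those
with `b = ⊤`. A finite `b` covers in particular the compact models (such as round spheres), with
the pole opposite to the origin removed. -/
structure IsModelFunction (h : ℝ → ℝ) (b : EReal) : Prop where
  radius_pos : 0 < b
  smooth : ContDiffOn ℝ ∞ h (radialInterval b)
  map_zero : h 0 = 0
  deriv_zero : derivWithin h (radialInterval b) 0 = 1
  even_derivs : ∀ k : ℕ, 1 ≤ k → iteratedDerivWithin (2 * k) h (radialInterval b) 0 = 0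
  pos : ∀ t : ℝ, 0 < t → (t : EReal) < b → 0 < h t

/-- The metric `dr² + h(r)² g_{S^{n-1}}` of a model, in Cartesian coordinates `x = r θ`: it is
`dr²` on radial vectors, `(h(r) / r)²` times the Euclidean metric on vectors tangent to the
sphere of radius `r`, and the Euclidean metric at the pole. -/
def modelMetric (n : ℕ) (h : ℝ → ℝ) : MetricField n := fun x =>
  if x = 0 then 1 else Matrix.of fun i j =>
    x i * x j / ‖x‖ ^ 2
      + (h ‖x‖ / ‖x‖) ^ 2 * ((if i = j then 1 else 0) - x i * x j / ‖x‖ ^ 2)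

/-- The flat metric of `ℝⁿ`. -/
def euclideanMetric (n : ℕ) : MetricField n := fun _ => 1

/-- The rotationally symmetric map `(θ, r) ↦ (θ, α(r))`, sending the pole to the pole. -/
def rotMap (n : ℕ) (α : ℝ → ℝ) : Coord n → Coord n := fun x => (α ‖x‖ / ‖x‖) • x

/-- A profile function `α` on `[0, R)`: it vanishes at `0`, and is smooth and positive on
`(0, R)`. -/
structure IsProfile (α : ℝ → ℝ) (R : EReal) : Prop where
  map_zero : α 0 = 0
  smooth : ContDiffOn ℝ ∞ α {t | 0 < t ∧ (t : EReal) < R}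
  pos : ∀ t : ℝ, 0 < t → (t : EReal) < R → 0 < α t

end BiharmonicModels

end

noncomputable section

namespace BiharmonicModels

/-! ### The radial frame -/

/-! Away from the pole everything is expressed through the unit radial vector `dir` and the
projection `tang` onto its orthogonal complement. Their contraction rules (`dir` has length one,
`tang` kills `dir`, is idempotent and has trace `n - 1`) and their first derivatives reduce every
tensor to functions of the radius.

For φ = `rotMap n α`, conformality compares the stretching `α'` along rays with the stretching
`h(α)/r` along spheres, so `α' = ± h(α)/r`. The sign is `+`, because a decreasing profile with limit
`0` at the pole could not be positive (`deriv_eq_of_conformal`). The tension field is radial, and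
for `n = 4` this equation turns its coefficient into `F = 2 h(α) (1 - h'(α)) / r²`
(`tension_rotMap`). For a radial field with coefficient `F`, `roughLaplacian_radial` and
`curvatureTrace_radial` give the radial coefficient of the bitension field as `F'' + 3 F'/r - 3 (h'²
+ h h'')(α) F / r²`. Since `r d/dr` acts on functions of `α` as `h d/dρ`, substituting `F` leaves a
multiple of the assumed equation: the coefficient is `-2 h(α)/r⁴` times its left-hand side,
evaluated at `α(r)` (`RegularProfile.bitension_eq_zero`).

At the pole the frame is undefined, but both metrics are even and φ is odd under `x ↦ -x`. The
bitension field is therefore odd and vanishes at the origin (`bitension_zero`). -/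

/-- The components of the radial unit vector `x / ‖x‖`. -/
def dir {n : ℕ} (i : Fin n) (x : Coord n) : ℝ := x i / ‖x‖

/-- The components of the orthogonal projection onto the complement of `x`. -/
def tang {n : ℕ} (i j : Fin n) (x : Coord n) : ℝ := (if i = j then 1 else 0) - dir i x * dir j x

theorem tang_comm {n : ℕ} (i j : Fin n) (x : Coord n) : tang i j x = tang j i x := by
  simp only [tang, eq_comm (a := i), mul_comm]

theorem sum_dir_mul_dir {n : ℕ} {x : Coord n} (hx : x ≠ 0) : ∑ i, dir i x * dir i x = 1 := by
  have h := EuclideanSpace.real_norm_sq_eq x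
  have hx' : ‖x‖ ≠ 0 := norm_ne_zero_iff.mpr hx
  have : ∀ i, dir i x * dir i x = x i ^ 2 / ‖x‖ ^ 2 := fun i => by simp only [dir]; ring
  simp_rw [this]
  rw [← Finset.sum_div, ← h]
  field_simp

theorem sum_tang_mul_dir {n : ℕ} {x : Coord n} (hx : x ≠ 0) (i : Fin n) :
    ∑ j, tang i j x * dir j x = 0 := by
  have : ∀ j, tang i j x * dir j x
      = (if i = j then dir j x else 0) - dir i x * (dir j x * dir j x) := fun j => by
    simp only [tang]; split_ifs <;> ring
  simp_rw [this]
  rw [Finset.sum_sub_distrib, ← Finset.mul_sum, sum_dir_mul_dir hx]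
  simp

theorem sum_dir_mul_tang {n : ℕ} {x : Coord n} (hx : x ≠ 0) (i : Fin n) :
    ∑ j, dir j x * tang j i x = 0 := by
  rw [← sum_tang_mul_dir hx i]
  exact Finset.sum_congr rfl fun j _ => by rw [tang_comm, mul_comm]

theorem sum_tang_mul_tang {n : ℕ} {x : Coord n} (hx : x ≠ 0) (i k : Fin n) :
    ∑ j, tang i j x * tang j k x = tang i k x := by
  have : ∀ j, tang i j x * tang j k x
      = (if j = k then tang i j x else 0) - dir k x * (tang i j x * dir j x) := fun j => by
    rw [show tang j k x = (if j = k then 1 else 0) - dir j x * dir k x from rfl]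
    split_ifs <;> ring
  simp_rw [this]
  rw [Finset.sum_sub_distrib, ← Finset.mul_sum, sum_tang_mul_dir hx]
  simp

theorem sum_tang_self {n : ℕ} {x : Coord n} (hx : x ≠ 0) : ∑ i, tang i i x = (n : ℝ) - 1 := by
  simp only [tang]
  rw [Finset.sum_sub_distrib, sum_dir_mul_dir hx]
  simp

/-- `rotMap` multiplies each point by a positive number, so the frame at the image point is the
frame at the source. Contractions along the map can thus all be done at `x`. -/
theorem dir_smul {n : ℕ} {c : ℝ} (hc : 0 < c) (x : Coord n) (i : Fin n) :
    dir i (c • x) = dir i x := by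
  simp only [dir, norm_smul, PiLp.smul_apply, smul_eq_mul, Real.norm_eq_abs, abs_of_pos hc]
  exact mul_div_mul_left _ _ hc.ne'

theorem tang_smul {n : ℕ} {c : ℝ} (hc : 0 < c) (x : Coord n) (i j : Fin n) :
    tang i j (c • x) = tang i j x := by
  simp only [tang, dir_smul hc]

/-! ### Calculus of partial derivatives -/

/-- `F` is differentiable at `x` with partial derivatives `D`. -/
structure HasPartials {n : ℕ} (F : Coord n → ℝ) (D : Fin n → ℝ) (x : Coord n) : Prop where
  differentiableAt : DifferentiableAt ℝ F x
  pd_eq : ∀ i, pd i F x = D i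

namespace HasPartials

variable {n : ℕ} {F G : Coord n → ℝ} {D E : Fin n → ℝ} {x : Coord n}

theorem add (hF : HasPartials F D x) (hG : HasPartials G E x) :
    HasPartials (fun y => F y + G y) (fun i => D i + E i) x where
  differentiableAt := hF.1.add hG.1
  pd_eq i := by
    rw [← hF.2, ← hG.2]; simp only [pd]; rw [fderiv_fun_add hF.1 hG.1]; rfl

theorem sub (hF : HasPartials F D x) (hG : HasPartials G E x) :
    HasPartials (fun y => F y - G y) (fun i => D i - E i) x where
  differentiableAt := hF.1.sub hG.1
  pd_eq i := by
    rw [← hF.2, ← hG.2]; simp only [pd]; rw [fderiv_fun_sub hF.1 hG.1]; rfl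

theorem mul (hF : HasPartials F D x) (hG : HasPartials G E x) :
    HasPartials (fun y => F y * G y) (fun i => F x * E i + G x * D i) x where
  differentiableAt := hF.1.mul hG.1
  pd_eq i := by
    rw [← hF.2, ← hG.2]; simp only [pd]; rw [fderiv_fun_mul hF.1 hG.1]; rfl

theorem const (c : ℝ) : HasPartials (fun _ => c) (fun _ => 0) x where
  differentiableAt := differentiableAt_const c
  pd_eq i := by simp [pd]

theorem congr (hF : HasPartials F D x) (h : G =ᶠ[nhds x] F) : HasPartials G D x where
  differentiableAt := hF.1.congr_of_eventuallyEq h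
  pd_eq i := by rw [← hF.2]; simp only [pd]; rw [h.fderiv_eq]

theorem congr_right (hF : HasPartials F D x) (h : ∀ i, D i = E i) : HasPartials F E x where
  differentiableAt := hF.1
  pd_eq i := by rw [hF.2, h]

theorem coord (j : Fin n) (x : Coord n) :
    HasPartials (fun y => y j) (fun i => if i = j then 1 else 0) x where
  differentiableAt := (EuclideanSpace.proj (𝕜 := ℝ) j).differentiableAt
  pd_eq i := by
    have : fderiv ℝ (fun y : Coord n => y j) x = EuclideanSpace.proj (𝕜 := ℝ) j :=
      (EuclideanSpace.proj (𝕜 := ℝ) j).fderiv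
    rw [pd, this]
    simp [eq_comm]

theorem norm (hx : x ≠ 0) : HasPartials (fun y => ‖y‖) (fun i => dir i x) x where
  differentiableAt := (contDiffAt_norm ℝ (n := 1) hx).differentiableAt one_ne_zero
  pd_eq i := by
    have h1 : DifferentiableAt ℝ (fun y : Coord n => ‖y‖) x :=
      (contDiffAt_norm ℝ (n := 1) hx).differentiableAt one_ne_zero
    have h2 := congrArg (fun L => L (EuclideanSpace.single i (1 : ℝ)))
      ((h1.hasFDerivAt.pow 2).unique (hasStrictFDerivAt_norm_sq x).hasFDerivAt)
    have h3 : ‖x‖ ≠ 0 := norm_ne_zero_iff.mpr hx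
    simp [EuclideanSpace.inner_single_right] at h2
    simp only [pd, dir]
    field_simp
    linarith

theorem radial {f : ℝ → ℝ} {f' : ℝ} (hx : x ≠ 0) (hf : HasDerivAt f f' ‖x‖) :
    HasPartials (fun y => f ‖y‖) (fun i => f' * dir i x) x where
  differentiableAt := hf.differentiableAt.comp x (norm hx).1
  pd_eq i := by
    rw [← (norm hx).2]
    have := (hf.comp_hasFDerivAt x (norm hx).1.hasFDerivAt).fderiv
    simp only [pd]
    change (fderiv ℝ (f ∘ fun y : Coord n => ‖y‖) x) _ = _
    rw [this]; rfl

theorem dir (hx : x ≠ 0) (j : Fin n) :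
    HasPartials (dir j) (fun i => tang i j x / ‖x‖) x := by
  have h3 : ‖x‖ ≠ 0 := norm_ne_zero_iff.mpr hx
  refine (((coord j x).mul (radial hx (hasDerivAt_inv h3)))).congr_right fun i => ?_
  simp only [tang, BiharmonicModels.dir]
  field_simp
  ring

theorem tang (hx : x ≠ 0) (j k : Fin n) :
    HasPartials (tang j k) (fun i => -(tang i j x * BiharmonicModels.dir k x
      + BiharmonicModels.dir j x * tang i k x) / ‖x‖) x :=
  ((const _).sub ((dir hx j).mul (dir hx k))).congr_right fun i => by ring

end HasPartials

theorem pd_congr {n : ℕ} {F G : Coord n → ℝ} {x : Coord n} (h : F =ᶠ[nhds x] G) (i : Fin n) :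
    pd i F x = pd i G x := by
  simp only [pd, h.fderiv_eq]

/-! ### Parity -/

/-- No differentiability is needed: composing with the linear equivalence `x ↦ -x` commutes with
`fderiv` even where its value is the default `0`. The parity argument therefore applies at the pole
without any regularity of the components. -/
theorem pd_of_odd {n : ℕ} {F : Coord n → ℝ} (hF : ∀ x, F (-x) = -F x) (i : Fin n) (x : Coord n) :
    pd i F (-x) = pd i F x := by
  have h1 : F = fun y => -F (-y) := funext fun y => by rw [hF, neg_neg]
  conv_rhs => rw [h1]
  simp only [pd]
  rw [fderiv_fun_neg]
  have := (ContinuousLinearEquiv.neg ℝ (M := Coord n)).comp_right_fderiv (f := F) (x := x)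
  change fderiv ℝ (fun y => F (-y)) x = (fderiv ℝ F (-x)).comp _ at this
  rw [this]
  simp

theorem pd_of_even {n : ℕ} {F : Coord n → ℝ} (hF : ∀ x, F (-x) = F x) (i : Fin n) (x : Coord n) :
    pd i F (-x) = -pd i F x := by
  have h1 : F = fun y => F (-y) := funext fun y => (hF y).symm
  conv_rhs => rw [h1]
  simp only [pd]
  have := (ContinuousLinearEquiv.neg ℝ (M := Coord n)).comp_right_fderiv (f := F) (x := x)
  change fderiv ℝ (fun y => F (-y)) x = (fderiv ℝ F (-x)).comp _ at this
  rw [this]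
  simp

section Parity

variable {m n : ℕ} {gM : MetricField m} {gN : MetricField n} {φ : Coord m → Coord n}

theorem christoffel_neg {g : MetricField n} (hg : ∀ x, g (-x) = g x) (k i j : Fin n)
    (x : Coord n) : christoffel g k i j (-x) = -christoffel g k i j x := by
  have h : ∀ i j l, pd l (fun y => g y i j) (-x) = -pd l (fun y => g y i j) x := fun i j l =>
    pd_of_even (fun y => by rw [hg]) l x
  simp only [christoffel, hg, h]
  rw [← mul_neg, ← Finset.sum_neg_distrib]
  congr 1
  exact Finset.sum_congr rfl fun l _ => by ring

theorem curvature_neg {g : MetricField n} (hg : ∀ x, g (-x) = g x) (l i j k : Fin n)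
    (x : Coord n) : curvature g l i j k (-x) = curvature g l i j k x := by
  simp only [curvature, christoffel_neg hg, pd_of_odd (christoffel_neg hg _ _ _), neg_mul_neg]

theorem dmap_neg (hφ : ∀ x, φ (-x) = -φ x) (a : Fin n) (i : Fin m) (x : Coord m) :
    dmap φ a i (-x) = dmap φ a i x :=
  pd_of_odd (fun y => by rw [hφ]; rfl) i x

theorem secondFundForm_neg (hM : ∀ x, gM (-x) = gM x) (hN : ∀ x, gN (-x) = gN x)
    (hφ : ∀ x, φ (-x) = -φ x) (c : Fin n) (i j : Fin m) (x : Coord m) :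
    secondFundForm gM gN φ c i j (-x) = -secondFundForm gM gN φ c i j x := by
  simp only [secondFundForm, hφ, christoffel_neg hM, christoffel_neg hN,
    dmap_neg hφ, pd_of_even (dmap_neg hφ _ _), neg_mul, Finset.sum_neg_distrib]
  ring

theorem tension_neg (hM : ∀ x, gM (-x) = gM x) (hN : ∀ x, gN (-x) = gN x)
    (hφ : ∀ x, φ (-x) = -φ x) (c : Fin n) (x : Coord m) :
    tension gM gN φ c (-x) = -tension gM gN φ c x := by
  simp only [tension, hM, secondFundForm_neg hM hN hφ, mul_neg, Finset.sum_neg_distrib]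

theorem pullbackDeriv_neg_of_odd (hN : ∀ x, gN (-x) = gN x) (hφ : ∀ x, φ (-x) = -φ x)
    {V : Fin n → Coord m → ℝ} (hV : ∀ c x, V c (-x) = -V c x) (i : Fin m) (c : Fin n)
    (x : Coord m) : pullbackDeriv gN φ i V c (-x) = pullbackDeriv gN φ i V c x := by
  simp only [pullbackDeriv, hφ, christoffel_neg hN, dmap_neg hφ, hV, pd_of_odd (hV c),
    neg_mul, mul_neg, neg_neg]

theorem pullbackDeriv_neg_of_even (hN : ∀ x, gN (-x) = gN x) (hφ : ∀ x, φ (-x) = -φ x)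
    {V : Fin n → Coord m → ℝ} (hV : ∀ c x, V c (-x) = V c x) (i : Fin m) (c : Fin n)
    (x : Coord m) : pullbackDeriv gN φ i V c (-x) = -pullbackDeriv gN φ i V c x := by
  simp only [pullbackDeriv, hφ, christoffel_neg hN, dmap_neg hφ, hV, pd_of_even (hV c),
    neg_mul, Finset.sum_neg_distrib]
  ring

/-- Parity count: the tension field is odd, its first covariant derivatives are even and the second
ones odd. In the curvature term, curvature and `dmap` are even and the tension field enters once. -/
theorem bitension_neg (hM : ∀ x, gM (-x) = gM x) (hN : ∀ x, gN (-x) = gN x)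
    (hφ : ∀ x, φ (-x) = -φ x) (c : Fin n) (x : Coord m) :
    bitension gM gN φ c (-x) = -bitension gM gN φ c x := by
  have hτ := tension_neg hM hN hφ
  have h1 := pullbackDeriv_neg_of_odd hN hφ hτ
  have h2 : ∀ i j c x, _ = _ := fun i j => pullbackDeriv_neg_of_even hN hφ (h1 j) i
  simp only [bitension, roughLaplacian, curvatureTrace, hM, hφ, hτ, h1, h2, christoffel_neg hM,
    dmap_neg hφ, curvature_neg hN, neg_mul, mul_neg, Finset.sum_neg_distrib, sub_neg_eq_add]
  have : ∀ a b : ℝ, -a + b = -(a - b) := fun a b => by ring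
  simp only [this, mul_neg, Finset.sum_neg_distrib]

/-- The bitension field vanishes at a fixed point of the antipodal symmetry. -/
theorem bitension_zero (hM : ∀ x, gM (-x) = gM x) (hN : ∀ x, gN (-x) = gN x)
    (hφ : ∀ x, φ (-x) = -φ x) (c : Fin n) : bitension gM gN φ c 0 = 0 := by
  have := bitension_neg hM hN hφ c 0
  rw [neg_zero] at this
  linarith

end Parity

/-! ### The Levi-Civita connection and the radial curvature of a model -/

section Model

variable {n : ℕ} {h : ℝ → ℝ}

theorem modelMetric_apply {x : Coord n} (hx : x ≠ 0) (i j : Fin n) :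
    modelMetric n h x i j = dir i x * dir j x + (h ‖x‖ / ‖x‖) ^ 2 * tang i j x := by
  simp only [modelMetric, if_neg hx, Matrix.of_apply, tang, dir]
  ring

theorem modelMetric_neg (x : Coord n) : modelMetric n h (-x) = modelMetric n h x := by
  simp only [modelMetric, neg_eq_zero, norm_neg, PiLp.neg_apply, neg_mul_neg]

/-- The metric acts as `1` on the radial line and as `(h/r)²` on its complement, so inverting it
inverts these two eigenvalues. -/
theorem modelMetric_inv_apply {x : Coord n} (hx : x ≠ 0) (hh : h ‖x‖ ≠ 0) (i j : Fin n) :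
    (modelMetric n h x)⁻¹ i j = dir i x * dir j x + (‖x‖ / h ‖x‖) ^ 2 * tang i j x := by
  have hr : ‖x‖ ≠ 0 := norm_ne_zero_iff.mpr hx
  have key : modelMetric n h x *
      Matrix.of (fun i j => dir i x * dir j x + (‖x‖ / h ‖x‖) ^ 2 * tang i j x) = 1 := by
    ext i k
    rw [Matrix.mul_apply, Matrix.one_apply]
    have e : ∀ j, modelMetric n h x i j *
        Matrix.of (fun i j => dir i x * dir j x + (‖x‖ / h ‖x‖) ^ 2 * tang i j x) j k
        = dir i x * dir k x * (dir j x * dir j x)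
          + (‖x‖ / h ‖x‖) ^ 2 * dir i x * (dir j x * tang j k x)
          + (h ‖x‖ / ‖x‖) ^ 2 * dir k x * (tang i j x * dir j x)
          + 1 * (tang i j x * tang j k x) := fun j => by
      rw [modelMetric_apply hx, Matrix.of_apply]
      field_simp
      ring
    simp_rw [e]
    simp only [Finset.sum_add_distrib, ← Finset.mul_sum, sum_dir_mul_dir hx,
      sum_dir_mul_tang hx, sum_tang_mul_dir hx, sum_tang_mul_tang hx]
    rw [tang]
    ring
  rw [Matrix.inv_eq_right_inv key, Matrix.of_apply]

theorem eventually_ne_zero {x : Coord n} (hx : x ≠ 0) : ∀ᶠ y in nhds x, y ≠ 0 :=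
  isOpen_ne.mem_nhds hx

theorem hasPartials_modelMetric {x : Coord n} (hx : x ≠ 0) (hd : DifferentiableAt ℝ h ‖x‖)
    (j l : Fin n) :
    HasPartials (fun y => modelMetric n h y j l)
      (fun i => (1 - (h ‖x‖ / ‖x‖) ^ 2) / ‖x‖ * (tang i j x * dir l x + dir j x * tang i l x)
        + 2 * (h ‖x‖ / ‖x‖) * (deriv h ‖x‖ / ‖x‖ - h ‖x‖ / ‖x‖ ^ 2) * dir i x * tang j l x) x := by
  have hr : ‖x‖ ≠ 0 := norm_ne_zero_iff.mpr hx
  have h1 : HasDerivAt (fun r => (h r / r) ^ 2) _ ‖x‖ :=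
    (hd.hasDerivAt.fun_div (hasDerivAt_id ‖x‖) hr).fun_pow 2
  refine (((((HasPartials.dir hx j).mul (HasPartials.dir hx l)).add
    ((HasPartials.radial hx h1).mul (HasPartials.tang hx j l))).congr
    ((eventually_ne_zero hx).mono fun y hy => modelMetric_apply hy j l)).congr_right) fun i => ?_
  simp only [id, Nat.add_one_sub_one, pow_one, Nat.cast_ofNat]
  field_simp
  ring

/-- The Christoffel symbols of the model metric. -/
theorem christoffel_modelMetric {x : Coord n} (hx : x ≠ 0) (hd : DifferentiableAt ℝ h ‖x‖)
    (hh : h ‖x‖ ≠ 0) (k i j : Fin n) :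
    christoffel (modelMetric n h) k i j x =
      (deriv h ‖x‖ / h ‖x‖ - 1 / ‖x‖) * (dir i x * tang j k x + dir j x * tang i k x)
        + (1 / ‖x‖ - h ‖x‖ * deriv h ‖x‖ / ‖x‖ ^ 2) * (tang i j x * dir k x) := by
  have hr : ‖x‖ ≠ 0 := norm_ne_zero_iff.mpr hx
  have e : ∀ l, (modelMetric n h x)⁻¹ k l *
      (pd i (fun y => modelMetric n h y j l) x + pd j (fun y => modelMetric n h y i l) x
        - pd l (fun y => modelMetric n h y i j) x)
      = (2 * (1 - (h ‖x‖ / ‖x‖) ^ 2) / ‖x‖ * tang i j x * dir k x) * (dir l x * dir l x)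
        + (2 * (1 - (h ‖x‖ / ‖x‖) ^ 2) / ‖x‖ * (‖x‖ / h ‖x‖) ^ 2 * tang i j x)
          * (tang k l x * dir l x)
        + 2 * (h ‖x‖ / ‖x‖) * (deriv h ‖x‖ / ‖x‖ - h ‖x‖ / ‖x‖ ^ 2) *
          (dir k x * dir i x * (dir l x * tang l j x) + dir k x * dir j x * (dir l x * tang l i x)
            - dir k x * tang i j x * (dir l x * dir l x)
            + (‖x‖ / h ‖x‖) ^ 2 * (dir i x * (tang k l x * tang l j x)
              + dir j x * (tang k l x * tang l i x) - tang i j x * (tang k l x * dir l x))) :=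
    fun l => by
      rw [modelMetric_inv_apply hx hh, (hasPartials_modelMetric hx hd j l).2,
        (hasPartials_modelMetric hx hd i l).2, (hasPartials_modelMetric hx hd i j).2,
        tang_comm l i, tang_comm l j, tang_comm j i]
      ring
  simp only [christoffel, e]
  simp only [Finset.sum_add_distrib, Finset.sum_sub_distrib, ← Finset.mul_sum, sum_dir_mul_dir hx,
    sum_dir_mul_tang hx, sum_tang_mul_dir hx, sum_tang_mul_tang hx]
  rw [tang_comm k j, tang_comm k i]
  field_simp
  ring

/-- The model metric has smooth positive profile at distances in `(0, b)`. -/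
structure RegularModel (h : ℝ → ℝ) (b : EReal) : Prop where
  contDiffAt : ∀ t : ℝ, 0 < t → (t : EReal) < b → ContDiffAt ℝ ∞ h t
  pos : ∀ t : ℝ, 0 < t → (t : EReal) < b → 0 < h t

theorem isOpen_coordBall (b : EReal) : IsOpen (coordBall n b) :=
  isOpen_lt (continuous_coe_real_ereal.comp continuous_norm) continuous_const

theorem contDiffAt_deriv {f : ℝ → ℝ} {t : ℝ} (hf : ContDiffAt ℝ ∞ f t) :
    ContDiffAt ℝ ∞ (deriv f) t :=
  (hf.fderiv_right (m := ∞) (by simp)).clm_apply contDiffAt_const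

theorem hasDerivAt_of_contDiffAt {f : ℝ → ℝ} {t : ℝ} (hf : ContDiffAt ℝ ∞ f t) :
    HasDerivAt f (deriv f t) t :=
  (hf.differentiableAt (by simp)).hasDerivAt

/-- The coefficient of the mixed part of the Christoffel symbols of a model. -/
def mixedCoeff (h : ℝ → ℝ) (r : ℝ) : ℝ := deriv h r / h r - 1 / r

/-- The coefficient of the radial part of the Christoffel symbols of a model. -/
def radialCoeff (h : ℝ → ℝ) (r : ℝ) : ℝ := 1 / r - h r * deriv h r / r ^ 2

variable {b : EReal}

/-- Naming the two coefficients as functions of the radius makes the formula differentiable by the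
chain rule. Both vanish for `h(r) = r`, the flat case. -/
theorem RegularModel.christoffel_eq (hm : RegularModel h b) {x : Coord n} (hx : x ≠ 0)
    (hxb : x ∈ coordBall n b) (k i j : Fin n) :
    christoffel (modelMetric n h) k i j x =
      mixedCoeff h ‖x‖ * (dir i x * tang j k x + dir j x * tang i k x)
        + radialCoeff h ‖x‖ * (tang i j x * dir k x) :=
  christoffel_modelMetric hx
    (hasDerivAt_of_contDiffAt (hm.contDiffAt _ (norm_pos_iff.mpr hx) hxb)).differentiableAt
    (hm.pos _ (norm_pos_iff.mpr hx) hxb).ne' k i j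

theorem RegularModel.hasPartials_christoffel (hm : RegularModel h b) {x : Coord n} (hx : x ≠ 0)
    (hxb : x ∈ coordBall n b) {f' g' : ℝ} (hf : HasDerivAt (mixedCoeff h) f' ‖x‖)
    (hg : HasDerivAt (radialCoeff h) g' ‖x‖) (k i j : Fin n) :
    HasPartials (christoffel (modelMetric n h) k i j)
      (fun a => f' * dir a x * (dir i x * tang j k x + dir j x * tang i k x)
        + g' * dir a x * (tang i j x * dir k x)
        + mixedCoeff h ‖x‖ / ‖x‖ *
          (tang a i x * tang j k x - dir i x * (tang a j x * dir k x + dir j x * tang a k x)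
            + tang a j x * tang i k x - dir j x * (tang a i x * dir k x + dir i x * tang a k x))
        + radialCoeff h ‖x‖ / ‖x‖ *
          (tang i j x * tang a k x - (tang a i x * dir j x + dir i x * tang a j x) * dir k x))
      x := by
  have hev : ∀ᶠ y in nhds x, y ≠ 0 ∧ y ∈ coordBall n b :=
    (eventually_ne_zero hx).and ((isOpen_coordBall b).mem_nhds hxb)
  have hr : ‖x‖ ≠ 0 := norm_ne_zero_iff.mpr hx
  refine (HasPartials.congr (((HasPartials.radial hx hf).mul
    (((HasPartials.dir hx i).mul (HasPartials.tang hx j k)).add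
      ((HasPartials.dir hx j).mul (HasPartials.tang hx i k)))).add
    ((HasPartials.radial hx hg).mul ((HasPartials.tang hx i j).mul (HasPartials.dir hx k))))
    (hev.mono fun y hy => hm.christoffel_eq hy.1 hy.2 k i j)).congr_right fun a => ?_
  field_simp
  ring

/-- This contraction and the next two are what the quadratic part of the radial curvature requires.
-/
theorem RegularModel.sum_christoffel_mul_dir (hm : RegularModel h b) {x : Coord n} (hx : x ≠ 0)
    (hxb : x ∈ coordBall n b) (k j : Fin n) :
    ∑ i, christoffel (modelMetric n h) k i j x * dir i x = mixedCoeff h ‖x‖ * tang j k x := by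
  have e : ∀ i, christoffel (modelMetric n h) k i j x * dir i x =
      mixedCoeff h ‖x‖ * (tang j k x * (dir i x * dir i x) + dir j x * (dir i x * tang i k x))
        + radialCoeff h ‖x‖ * dir k x * (dir i x * tang i j x) := fun i => by
    rw [hm.christoffel_eq hx hxb]; ring
  simp only [e, Finset.sum_add_distrib, ← Finset.mul_sum, sum_dir_mul_dir hx,
    sum_dir_mul_tang hx]
  ring

theorem RegularModel.sum_tang_mul_christoffel (hm : RegularModel h b) {x : Coord n} (hx : x ≠ 0)
    (hxb : x ∈ coordBall n b) (k i c : Fin n) :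
    ∑ j, tang c j x * christoffel (modelMetric n h) k i j x =
      mixedCoeff h ‖x‖ * dir i x * tang c k x + radialCoeff h ‖x‖ * tang i c x * dir k x := by
  have e : ∀ j, tang c j x * christoffel (modelMetric n h) k i j x =
      mixedCoeff h ‖x‖ * (dir i x * (tang c j x * tang j k x)
        + tang i k x * (tang c j x * dir j x))
        + radialCoeff h ‖x‖ * dir k x * (tang c j x * tang j i x) := fun j => by
    rw [hm.christoffel_eq hx hxb, tang_comm i j]; ring
  simp only [e, Finset.sum_add_distrib, ← Finset.mul_sum, sum_tang_mul_tang hx,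
    sum_tang_mul_dir hx, tang_comm c i]
  ring

theorem RegularModel.sum_christoffel_mul_tang (hm : RegularModel h b) {x : Coord n} (hx : x ≠ 0)
    (hxb : x ∈ coordBall n b) (i j d : Fin n) :
    ∑ k, christoffel (modelMetric n h) k i j x * tang k d x =
      mixedCoeff h ‖x‖ * (dir i x * tang j d x + dir j x * tang i d x) := by
  have e : ∀ k, christoffel (modelMetric n h) k i j x * tang k d x =
      mixedCoeff h ‖x‖ * (dir i x * (tang j k x * tang k d x)
        + dir j x * (tang i k x * tang k d x))
        + radialCoeff h ‖x‖ * tang i j x * (dir k x * tang k d x) := fun k => by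
    rw [hm.christoffel_eq hx hxb]; ring
  simp only [e, Finset.sum_add_distrib, ← Finset.mul_sum, sum_tang_mul_tang hx,
    sum_dir_mul_tang hx]
  ring

/-- The curvature of a model metric in planes containing the radial direction. -/
theorem RegularModel.sum_curvature_mul_dir (hm : RegularModel h b) {x : Coord n} (hx : x ≠ 0)
    (hxb : x ∈ coordBall n b) (d a c : Fin n) :
    ∑ e, curvature (modelMetric n h) d a e c x * dir e x =
      h ‖x‖ * deriv (deriv h) ‖x‖ / ‖x‖ ^ 2 * tang a c x * dir d x
        - deriv (deriv h) ‖x‖ / h ‖x‖ * tang a d x * dir c x := by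
  have hr : ‖x‖ ≠ 0 := norm_ne_zero_iff.mpr hx
  have hpos := norm_pos_iff.mpr hx
  have hh : h ‖x‖ ≠ 0 := (hm.pos _ hpos hxb).ne'
  have hc := hm.contDiffAt _ hpos hxb
  have h1 := hasDerivAt_of_contDiffAt hc
  have h2 := hasDerivAt_of_contDiffAt (contDiffAt_deriv hc)
  have hi : HasDerivAt (fun r : ℝ => 1 / r) _ ‖x‖ :=
    (hasDerivAt_const ‖x‖ (1 : ℝ)).fun_div (hasDerivAt_id ‖x‖) hr
  have hf : HasDerivAt (mixedCoeff h) _ ‖x‖ := (h2.fun_div h1 hh).fun_sub hi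
  have hg : HasDerivAt (radialCoeff h) _ ‖x‖ :=
    hi.fun_sub ((h1.fun_mul h2).fun_div ((hasDerivAt_id ‖x‖).fun_pow 2) (pow_ne_zero 2 hr))
  -- In each product ΓΓ the factor carrying the index `e` is contracted with `dir` before the sum
  -- over `s`; it collapses to `mixedCoeff` times `tang`.
  have quad : ∑ e, (∑ s, (christoffel (modelMetric n h) s e c x
        * christoffel (modelMetric n h) d a s x
      - christoffel (modelMetric n h) s a c x * christoffel (modelMetric n h) d e s x)) * dir e x
      = mixedCoeff h ‖x‖ * radialCoeff h ‖x‖ * tang a c x * dir d x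
        - mixedCoeff h ‖x‖ ^ 2 * dir c x * tang a d x := by
    have e1 : ∀ e, (∑ s, (christoffel (modelMetric n h) s e c x
          * christoffel (modelMetric n h) d a s x
        - christoffel (modelMetric n h) s a c x * christoffel (modelMetric n h) d e s x))
          * dir e x
        = ∑ s, (christoffel (modelMetric n h) d a s x
            * (christoffel (modelMetric n h) s e c x * dir e x)
          - christoffel (modelMetric n h) s a c x
            * (christoffel (modelMetric n h) d e s x * dir e x)) := fun e => by
      rw [Finset.sum_mul]; exact Finset.sum_congr rfl fun s _ => by ring
    simp_rw [e1]
    rw [Finset.sum_comm]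
    simp only [Finset.sum_sub_distrib, ← Finset.mul_sum, hm.sum_christoffel_mul_dir hx hxb]
    have e2 : ∀ s, christoffel (modelMetric n h) d a s x * (mixedCoeff h ‖x‖ * tang c s x)
        = mixedCoeff h ‖x‖ * (tang c s x * christoffel (modelMetric n h) d a s x) :=
      fun s => by ring
    have e3 : ∀ s, christoffel (modelMetric n h) s a c x * (mixedCoeff h ‖x‖ * tang s d x)
        = mixedCoeff h ‖x‖ * (christoffel (modelMetric n h) s a c x * tang s d x) :=
      fun s => by ring
    simp only [e2, e3, ← Finset.mul_sum, hm.sum_tang_mul_christoffel hx hxb,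
      hm.sum_christoffel_mul_tang hx hxb]
    ring
  have e0 : ∀ p q r s : ℝ, (p - q + r) * s = p * s - q * s + r * s := fun p q r s => by ring
  simp only [curvature, e0]
  rw [Finset.sum_add_distrib, quad]
  simp only [(hm.hasPartials_christoffel hx hxb hf hg _ _ _).2]
  have lin1 : ∀ f' g' : ℝ, ∑ e, (f' * dir a x * (dir e x * tang c d x + dir c x * tang e d x)
        + g' * dir a x * (tang e c x * dir d x)
        + mixedCoeff h ‖x‖ / ‖x‖ *
          (tang a e x * tang c d x - dir e x * (tang a c x * dir d x + dir c x * tang a d x)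
            + tang a c x * tang e d x - dir c x * (tang a e x * dir d x + dir e x * tang a d x))
        + radialCoeff h ‖x‖ / ‖x‖ *
          (tang e c x * tang a d x - (tang a e x * dir c x + dir e x * tang a c x) * dir d x))
        * dir e x = f' * dir a x * tang c d x
          - mixedCoeff h ‖x‖ / ‖x‖ * (tang a c x * dir d x + 2 * dir c x * tang a d x)
          - radialCoeff h ‖x‖ / ‖x‖ * (tang a c x * dir d x) := fun f' g' => by
    have e1 : ∀ e, (f' * dir a x * (dir e x * tang c d x + dir c x * tang e d x)
        + g' * dir a x * (tang e c x * dir d x)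
        + mixedCoeff h ‖x‖ / ‖x‖ *
          (tang a e x * tang c d x - dir e x * (tang a c x * dir d x + dir c x * tang a d x)
            + tang a c x * tang e d x - dir c x * (tang a e x * dir d x + dir e x * tang a d x))
        + radialCoeff h ‖x‖ / ‖x‖ *
          (tang e c x * tang a d x - (tang a e x * dir c x + dir e x * tang a c x) * dir d x))
        * dir e x = (f' * dir a x * tang c d x
          - mixedCoeff h ‖x‖ / ‖x‖ * (tang a c x * dir d x + 2 * dir c x * tang a d x)
          - radialCoeff h ‖x‖ / ‖x‖ * (tang a c x * dir d x)) * (dir e x * dir e x)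
        + (f' * dir a x * dir c x + mixedCoeff h ‖x‖ / ‖x‖ * tang a c x) * (dir e x * tang e d x)
        + (g' * dir a x * dir d x + radialCoeff h ‖x‖ / ‖x‖ * tang a d x) * (dir e x * tang e c x)
        + (mixedCoeff h ‖x‖ / ‖x‖ * (tang c d x - dir c x * dir d x)
          - radialCoeff h ‖x‖ / ‖x‖ * dir c x * dir d x) * (tang a e x * dir e x) := fun e => by
      ring
    simp only [e1, Finset.sum_add_distrib, ← Finset.mul_sum, sum_dir_mul_dir hx,
      sum_dir_mul_tang hx, sum_tang_mul_dir hx]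
    ring
  -- This is the derivative along the ray. The frame is constant on rays, so only the derivatives of
  -- the two coefficients survive.
  have lin2 : ∀ f' g' : ℝ, ∑ e, (f' * dir e x * (dir a x * tang c d x + dir c x * tang a d x)
        + g' * dir e x * (tang a c x * dir d x)
        + mixedCoeff h ‖x‖ / ‖x‖ *
          (tang e a x * tang c d x - dir a x * (tang e c x * dir d x + dir c x * tang e d x)
            + tang e c x * tang a d x - dir c x * (tang e a x * dir d x + dir a x * tang e d x))
        + radialCoeff h ‖x‖ / ‖x‖ *
          (tang a c x * tang e d x - (tang e a x * dir c x + dir a x * tang e c x) * dir d x))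
        * dir e x = f' * (dir a x * tang c d x + dir c x * tang a d x)
          + g' * (tang a c x * dir d x) := fun f' g' => by
    have e1 : ∀ e, (f' * dir e x * (dir a x * tang c d x + dir c x * tang a d x)
        + g' * dir e x * (tang a c x * dir d x)
        + mixedCoeff h ‖x‖ / ‖x‖ *
          (tang e a x * tang c d x - dir a x * (tang e c x * dir d x + dir c x * tang e d x)
            + tang e c x * tang a d x - dir c x * (tang e a x * dir d x + dir a x * tang e d x))
        + radialCoeff h ‖x‖ / ‖x‖ *
          (tang a c x * tang e d x - (tang e a x * dir c x + dir a x * tang e c x) * dir d x))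
        * dir e x = (f' * (dir a x * tang c d x + dir c x * tang a d x)
          + g' * (tang a c x * dir d x)) * (dir e x * dir e x)
        + (mixedCoeff h ‖x‖ / ‖x‖ * (tang c d x - dir c x * dir d x)
          - radialCoeff h ‖x‖ / ‖x‖ * dir c x * dir d x) * (dir e x * tang e a x)
        + (mixedCoeff h ‖x‖ / ‖x‖ * (tang a d x - dir a x * dir d x)
          - radialCoeff h ‖x‖ / ‖x‖ * dir a x * dir d x) * (dir e x * tang e c x)
        + (radialCoeff h ‖x‖ / ‖x‖ * tang a c x
          - 2 * (mixedCoeff h ‖x‖ / ‖x‖) * dir a x * dir c x) * (dir e x * tang e d x) :=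
      fun e => by ring
    simp only [e1, Finset.sum_add_distrib, ← Finset.mul_sum, sum_dir_mul_dir hx,
      sum_dir_mul_tang hx]
    ring
  rw [Finset.sum_sub_distrib, lin1, lin2]
  simp only [id, mixedCoeff, radialCoeff, Nat.add_one_sub_one, pow_one, Nat.cast_ofNat]
  field_simp
  ring

end Model

/-! ### Rotationally symmetric maps into a model -/

section RotMap

variable {n : ℕ} {h α : ℝ → ℝ} {b R : EReal}

/-- The profile `α` is smooth on `(0, R)` with values in `(0, b)`. -/
structure RegularProfile (α : ℝ → ℝ) (R b : EReal) : Prop where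
  contDiffAt : ∀ t : ℝ, 0 < t → (t : EReal) < R → ContDiffAt ℝ ∞ α t
  pos : ∀ t : ℝ, 0 < t → (t : EReal) < R → 0 < α t
  lt : ∀ t : ℝ, 0 < t → (t : EReal) < R → (α t : EReal) < b

/-- The ball of radius `R` with its centre removed. -/
def puncturedBall (n : ℕ) (R : EReal) : Set (Coord n) := {x | x ≠ 0 ∧ x ∈ coordBall n R}

theorem isOpen_puncturedBall : IsOpen (puncturedBall n R) :=
  isOpen_ne.inter (isOpen_coordBall R)

theorem rotMap_neg (x : Coord n) : rotMap n α (-x) = -rotMap n α x := by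
  simp only [rotMap, norm_neg, smul_neg]

theorem rotMap_apply (x : Coord n) (c : Fin n) : rotMap n α x c = α ‖x‖ * dir c x := by
  simp only [rotMap, PiLp.smul_apply, smul_eq_mul, dir]
  ring

variable {x : Coord n}

theorem hasPartials_radial_mul_dir (hx : x ≠ 0) {f : ℝ → ℝ} {f' : ℝ} (hf : HasDerivAt f f' ‖x‖)
    (c : Fin n) : HasPartials (fun y => f ‖y‖ * dir c y)
      (fun i => f' * (dir i x * dir c x) + f ‖x‖ / ‖x‖ * tang i c x) x :=
  ((HasPartials.radial hx hf).mul (HasPartials.dir hx c)).congr_right fun i => by ring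

theorem hasPartials_radial_mul_tang (hx : x ≠ 0) {f : ℝ → ℝ} {f' : ℝ} (hf : HasDerivAt f f' ‖x‖)
    (c j : Fin n) : HasPartials (fun y => f ‖y‖ * tang c j y)
      (fun i => f' * (dir i x * tang c j x)
        - f ‖x‖ / ‖x‖ * (tang i c x * dir j x + dir c x * tang i j x)) x :=
  ((HasPartials.radial hx hf).mul (HasPartials.tang hx c j)).congr_right fun i => by ring

theorem hasPartials_radial_mul_dir_mul_dir (hx : x ≠ 0) {f : ℝ → ℝ} {f' : ℝ}
    (hf : HasDerivAt f f' ‖x‖) (c j : Fin n) : HasPartials (fun y => f ‖y‖ * (dir c y * dir j y))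
      (fun i => f' * (dir i x * (dir c x * dir j x))
        + f ‖x‖ / ‖x‖ * (tang i c x * dir j x + dir c x * tang i j x)) x :=
  ((HasPartials.radial hx hf).mul
    ((HasPartials.dir hx c).mul (HasPartials.dir hx j))).congr_right fun i => by ring

/-- The divergence of a rotationally symmetric field of endomorphisms. -/
theorem sum_pd_radial_endomorphism (hx : x ≠ 0) {f k : ℝ → ℝ} {f' k' : ℝ}
    (hf : HasDerivAt f f' ‖x‖) (hk : HasDerivAt k k' ‖x‖) (c : Fin n) :
    ∑ i, pd i (fun y => f ‖y‖ * (dir c y * dir i y) + k ‖y‖ * tang c i y) x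
      = (f' + (n - 1) * f ‖x‖ / ‖x‖ - (n - 1) * k ‖x‖ / ‖x‖) * dir c x := by
  have e : ∀ i, pd i (fun y => f ‖y‖ * (dir c y * dir i y) + k ‖y‖ * tang c i y) x
      = f' * dir c x * (dir i x * dir i x) + (f ‖x‖ / ‖x‖ - k ‖x‖ / ‖x‖) * (dir i x * tang i c x)
        + (f ‖x‖ / ‖x‖ - k ‖x‖ / ‖x‖) * dir c x * tang i i x
        -- The derivative of the tangential coefficient meets only `tang` applied to `dir`, which is
        -- zero; hence `k'` is absent from the divergence.
        + k' * (tang c i x * dir i x) := fun i => by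
    rw [((hasPartials_radial_mul_dir_mul_dir hx hf c i).add
      (hasPartials_radial_mul_tang hx hk c i)).2]
    ring
  simp only [e, Finset.sum_add_distrib, ← Finset.mul_sum, sum_dir_mul_dir hx,
    sum_dir_mul_tang hx, sum_tang_mul_dir hx, sum_tang_self hx]
  ring

theorem RegularProfile.hasDerivAt (hp : RegularProfile α R b) (hx : x ∈ puncturedBall n R) :
    HasDerivAt α (deriv α ‖x‖) ‖x‖ :=
  hasDerivAt_of_contDiffAt (hp.contDiffAt _ (norm_pos_iff.mpr hx.1) hx.2)

theorem RegularProfile.dmap_rotMap (hp : RegularProfile α R b) (hx : x ∈ puncturedBall n R)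
    (c i : Fin n) : dmap (rotMap n α) c i x =
      deriv α ‖x‖ * (dir c x * dir i x) + α ‖x‖ / ‖x‖ * tang c i x := by
  simp only [dmap, rotMap_apply]
  rw [(hasPartials_radial_mul_dir hx.1 (hp.hasDerivAt hx) c).2, mul_comm (dir i x), tang_comm]

theorem RegularProfile.norm_rotMap (hp : RegularProfile α R b) (hx : x ∈ puncturedBall n R) :
    ‖rotMap n α x‖ = α ‖x‖ := by
  have hr := norm_pos_iff.mpr hx.1
  rw [rotMap, norm_smul, Real.norm_eq_abs, abs_of_pos (div_pos (hp.pos _ hr hx.2) hr)]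
  field_simp

theorem RegularProfile.rotMap_mem (hp : RegularProfile α R b) (hx : x ∈ puncturedBall n R) :
    rotMap n α x ∈ puncturedBall n b := by
  have hr := norm_pos_iff.mpr hx.1
  refine ⟨norm_pos_iff.mp ?_, ?_⟩
  · rw [hp.norm_rotMap hx]; exact hp.pos _ hr hx.2
  · change ((‖rotMap n α x‖ : ℝ) : EReal) < b
    rw [hp.norm_rotMap hx]; exact hp.lt _ hr hx.2

theorem RegularProfile.dir_rotMap (hp : RegularProfile α R b) (hx : x ∈ puncturedBall n R)
    (i : Fin n) : dir i (rotMap n α x) = dir i x :=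
  dir_smul (div_pos (hp.pos _ (norm_pos_iff.mpr hx.1) hx.2) (norm_pos_iff.mpr hx.1)) x i

theorem RegularProfile.tang_rotMap (hp : RegularProfile α R b) (hx : x ∈ puncturedBall n R)
    (i j : Fin n) : tang i j (rotMap n α x) = tang i j x :=
  tang_smul (div_pos (hp.pos _ (norm_pos_iff.mpr hx.1) hx.2) (norm_pos_iff.mpr hx.1)) x i j

/-- The connection form of the pulled back Levi-Civita connection, applied to a field with
a radial and a tangential part. -/
theorem RegularProfile.sum_christoffel_rotMap (hp : RegularProfile α R b) (hm : RegularModel h b)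
    (hx : x ∈ puncturedBall n R) (c i j : Fin n) (v w : ℝ) :
    ∑ a, ∑ e, christoffel (modelMetric n h) c a e (rotMap n α x) * dmap (rotMap n α) a i x
        * (v * dir e x + w * tang e j x) =
      mixedCoeff h (α ‖x‖) * (deriv α ‖x‖ * w * dir i x * tang c j x
          + α ‖x‖ / ‖x‖ * v * tang c i x)
        + radialCoeff h (α ‖x‖) * (α ‖x‖ / ‖x‖) * w * tang i j x * dir c x := by
  have hφ := hp.rotMap_mem hx
  have e1 : ∀ a e, christoffel (modelMetric n h) c a e (rotMap n α x)
      * dmap (rotMap n α) a i x * (v * dir e x + w * tang e j x)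
      = (mixedCoeff h (α ‖x‖) * dmap (rotMap n α) a i x * v * tang a c x)
          * (dir e x * dir e x)
        + (mixedCoeff h (α ‖x‖) * dmap (rotMap n α) a i x * v * dir a x)
          * (dir e x * tang e c x)
        + (mixedCoeff h (α ‖x‖) * dmap (rotMap n α) a i x * w * dir a x)
          * (tang c e x * tang e j x)
        + (mixedCoeff h (α ‖x‖) * dmap (rotMap n α) a i x * w * tang a c x)
          * (dir e x * tang e j x)
        + (radialCoeff h (α ‖x‖) * dmap (rotMap n α) a i x * v * dir c x)
          * (tang a e x * dir e x)
        + (radialCoeff h (α ‖x‖) * dmap (rotMap n α) a i x * w * dir c x)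
          * (tang a e x * tang e j x) := fun a e => by
    rw [hm.christoffel_eq hφ.1 hφ.2]
    simp only [hp.norm_rotMap hx, hp.dir_rotMap hx, hp.tang_rotMap hx]
    rw [tang_comm c e]
    ring
  simp only [e1, Finset.sum_add_distrib, ← Finset.mul_sum, sum_dir_mul_dir hx.1,
    sum_dir_mul_tang hx.1, sum_tang_mul_dir hx.1, sum_tang_mul_tang hx.1]
  rw [← Finset.sum_add_distrib, ← Finset.sum_add_distrib, ← Finset.sum_add_distrib,
    ← Finset.sum_add_distrib, ← Finset.sum_add_distrib]
  -- The left-hand side is the summand remaining after the sum over `e`; the `show` below fixes it.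
  have e2 : ∀ a, _ = (mixedCoeff h (α ‖x‖) * deriv α ‖x‖ * w * tang c j x * dir i x)
        * (dir a x * dir a x)
      + (mixedCoeff h (α ‖x‖) * (α ‖x‖ / ‖x‖) * w * tang c j x) * (dir a x * tang a i x)
      + (mixedCoeff h (α ‖x‖) * deriv α ‖x‖ * v * dir i x) * (dir a x * tang a c x)
      + (mixedCoeff h (α ‖x‖) * (α ‖x‖ / ‖x‖) * v) * (tang c a x * tang a i x)
      + (radialCoeff h (α ‖x‖) * deriv α ‖x‖ * w * dir c x * dir i x) * (dir a x * tang a j x)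
      + (radialCoeff h (α ‖x‖) * (α ‖x‖ / ‖x‖) * w * dir c x) * (tang i a x * tang a j x) :=
    fun a => by
      rw [← sub_eq_zero]
      show (mixedCoeff h (α ‖x‖) * dmap (rotMap n α) a i x * v * tang a c x) * 1
        + (mixedCoeff h (α ‖x‖) * dmap (rotMap n α) a i x * v * dir a x) * 0
        + (mixedCoeff h (α ‖x‖) * dmap (rotMap n α) a i x * w * dir a x) * tang c j x
        + (mixedCoeff h (α ‖x‖) * dmap (rotMap n α) a i x * w * tang a c x) * 0
        + (radialCoeff h (α ‖x‖) * dmap (rotMap n α) a i x * v * dir c x) * 0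
        + (radialCoeff h (α ‖x‖) * dmap (rotMap n α) a i x * w * dir c x) * tang a j x - _ = 0
      rw [hp.dmap_rotMap hx, tang_comm c a, tang_comm i a]
      ring
  simp only [e2, Finset.sum_add_distrib, ← Finset.mul_sum, sum_dir_mul_dir hx.1,
    sum_dir_mul_tang hx.1, sum_tang_mul_tang hx.1]
  ring

/-! ### Flat domains -/

theorem sum_euclideanMetric_inv {m : ℕ} (y : Coord m) (f : Fin m → Fin m → ℝ) :
    ∑ i, ∑ j, (euclideanMetric m y)⁻¹ i j * f i j = ∑ i, f i i := by
  simp [euclideanMetric, Matrix.one_apply]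

theorem christoffel_euclideanMetric {m : ℕ} (k i j : Fin m) (y : Coord m) :
    christoffel (euclideanMetric m) k i j y = 0 := by
  simp [christoffel, euclideanMetric, pd]

/-- The tension field of a rotationally symmetric map is radial. -/
theorem RegularProfile.tension_rotMap (hp : RegularProfile α R b) (hm : RegularModel h b)
    (hx : x ∈ puncturedBall n R) (c : Fin n) :
    tension (euclideanMetric n) (modelMetric n h) (rotMap n α) c x =
      (deriv (deriv α) ‖x‖ + (n - 1) * deriv α ‖x‖ / ‖x‖
        - (n - 1) * (h (α ‖x‖) * deriv h (α ‖x‖)) / ‖x‖ ^ 2) * dir c x := by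
  have hr := norm_pos_iff.mpr hx.1
  have hα := hp.contDiffAt _ hr hx.2
  have hk : HasDerivAt (fun r => α r / r) _ ‖x‖ :=
    (hp.hasDerivAt hx).fun_div (hasDerivAt_id _) hr.ne'
  have e1 : ∀ i, pd i (dmap (rotMap n α) c i) x
      = pd i (fun y => deriv α ‖y‖ * (dir c y * dir i y) + α ‖y‖ / ‖y‖ * tang c i y) x :=
    fun i => pd_congr (Filter.eventuallyEq_of_mem (isOpen_puncturedBall.mem_nhds hx)
      fun y hy => hp.dmap_rotMap hy c i) i
  have e2 : ∀ i, ∑ a, ∑ e, christoffel (modelMetric n h) c a e (rotMap n α x)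
        * dmap (rotMap n α) a i x * dmap (rotMap n α) e i x
      = mixedCoeff h (α ‖x‖) * deriv α ‖x‖ * (α ‖x‖ / ‖x‖) * (tang c i x * dir i x)
        + mixedCoeff h (α ‖x‖) * deriv α ‖x‖ * (α ‖x‖ / ‖x‖) * (tang c i x * dir i x)
        + radialCoeff h (α ‖x‖) * (α ‖x‖ / ‖x‖) ^ 2 * dir c x * tang i i x := fun i => by
    -- The column `i` of the differential is itself of the form `v * dir + w * tang`, with `v = α' *
    -- dir i` and `w = α / r`.
    have := hp.sum_christoffel_rotMap hm hx c i i (deriv α ‖x‖ * dir i x) (α ‖x‖ / ‖x‖)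
    have e3 : ∀ e, deriv α ‖x‖ * dir i x * dir e x + α ‖x‖ / ‖x‖ * tang e i x
        = dmap (rotMap n α) e i x := fun e => by rw [hp.dmap_rotMap hx]; ring
    simp only [e3] at this
    rw [this]
    ring
  simp only [tension, sum_euclideanMetric_inv, secondFundForm, christoffel_euclideanMetric,
    zero_mul, Finset.sum_const_zero, sub_zero, e1, e2, Finset.sum_add_distrib, ← Finset.mul_sum,
    sum_tang_mul_dir hx.1, sum_tang_self hx.1]
  rw [sum_pd_radial_endomorphism hx.1 (hasDerivAt_of_contDiffAt (contDiffAt_deriv hα)) hk]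
  have := (hp.pos _ hr hx.2).ne'
  simp only [radialCoeff]
  field_simp
  ring

/-- In a model `∂_ρ` is geodesic and its covariant derivative in a tangential direction is `h'/h`
times that direction. The map stretches tangential coordinate vectors by `α/r`, which gives the
coefficient of `tang`. -/
theorem RegularProfile.pullbackDeriv_radial (hp : RegularProfile α R b) (hm : RegularModel h b)
    (hx : x ∈ puncturedBall n R) {V : Fin n → Coord n → ℝ} {F : ℝ → ℝ} {F' : ℝ}
    (hV : ∀ c, ∀ y ∈ puncturedBall n R, V c y = F ‖y‖ * dir c y) (hF : HasDerivAt F F' ‖x‖)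
    (i c : Fin n) :
    pullbackDeriv (modelMetric n h) (rotMap n α) i V c x =
      F' * (dir c x * dir i x)
        + F ‖x‖ * α ‖x‖ * deriv h (α ‖x‖) / (h (α ‖x‖) * ‖x‖) * tang c i x := by
  have hr := norm_pos_iff.mpr hx.1
  have hα := (hp.pos _ hr hx.2).ne'
  have hh := (hm.pos _ (hp.pos _ hr hx.2) (hp.lt _ hr hx.2)).ne'
  have e1 : pd i (V c) x = pd i (fun y => F ‖y‖ * dir c y) x :=
    pd_congr (Filter.eventuallyEq_of_mem (isOpen_puncturedBall.mem_nhds hx) fun y hy => hV c y hy) i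
  have e2 := hp.sum_christoffel_rotMap hm hx c i i (F ‖x‖) 0
  simp only [zero_mul, add_zero, ← hV _ x hx] at e2
  rw [pullbackDeriv, e1, (hasPartials_radial_mul_dir hx.1 hF c).2, e2, tang_comm i c]
  simp only [mixedCoeff]
  field_simp
  ring

/-- The rough Laplacian of a radial section along a rotationally symmetric map. -/
theorem RegularProfile.roughLaplacian_radial (hp : RegularProfile α R b) (hm : RegularModel h b)
    (hx : x ∈ puncturedBall n R) {V : Fin n → Coord n → ℝ} {F F' : ℝ → ℝ} {F'' : ℝ}
    (hV : ∀ c, ∀ y ∈ puncturedBall n R, V c y = F ‖y‖ * dir c y)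
    (hF : ∀ t : ℝ, 0 < t → (t : EReal) < R → HasDerivAt F (F' t) t)
    (hF' : HasDerivAt F' F'' ‖x‖) (c : Fin n) :
    roughLaplacian (euclideanMetric n) (modelMetric n h) (rotMap n α) V c x =
      -(F'' + (n - 1) * F' ‖x‖ / ‖x‖
        - (n - 1) * deriv h (α ‖x‖) ^ 2 / ‖x‖ ^ 2 * F ‖x‖) * dir c x := by
  have hr := norm_pos_iff.mpr hx.1
  have hα := (hp.pos _ hr hx.2).ne'
  have hhm := hm.contDiffAt _ (hp.pos _ hr hx.2) (hp.lt _ hr hx.2)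
  have hh := (hm.pos _ (hp.pos _ hr hx.2) (hp.lt _ hr hx.2)).ne'
  -- `K` is the tangential coefficient of the covariant derivative of `V`. Its derivative cancels
  -- from the divergence, so the value in `hKd` may stay implicit.
  set K : ℝ → ℝ := fun r => F r * α r * deriv h (α r) / (h (α r) * r) with hK
  have hα' := hp.hasDerivAt hx
  have hKd : HasDerivAt K _ ‖x‖ :=
    (((hF _ hr hx.2).fun_mul hα').fun_mul
      ((hasDerivAt_of_contDiffAt (contDiffAt_deriv hhm)).comp ‖x‖ hα')).fun_div
      (((hasDerivAt_of_contDiffAt hhm).comp ‖x‖ hα').fun_mul (hasDerivAt_id ‖x‖))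
      (mul_ne_zero hh hr.ne')
  have e0 : ∀ i, ∀ y ∈ puncturedBall n R, pullbackDeriv (modelMetric n h) (rotMap n α) i V c y
      = F' ‖y‖ * (dir c y * dir i y) + K ‖y‖ * tang c i y := fun i y hy =>
    hp.pullbackDeriv_radial hm hy hV (hF _ (norm_pos_iff.mpr hy.1) hy.2) i c
  have e1 : ∀ i, pd i (pullbackDeriv (modelMetric n h) (rotMap n α) i V c) x
      = pd i (fun y => F' ‖y‖ * (dir c y * dir i y) + K ‖y‖ * tang c i y) x := fun i =>
    pd_congr (Filter.eventuallyEq_of_mem (isOpen_puncturedBall.mem_nhds hx) (e0 i)) i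
  have e2 : ∀ i, ∑ a, ∑ e, christoffel (modelMetric n h) c a e (rotMap n α x)
        * dmap (rotMap n α) a i x * pullbackDeriv (modelMetric n h) (rotMap n α) i V e x
      = mixedCoeff h (α ‖x‖) * (deriv α ‖x‖ * K ‖x‖ + α ‖x‖ / ‖x‖ * F' ‖x‖)
          * (tang c i x * dir i x)
        + radialCoeff h (α ‖x‖) * (α ‖x‖ / ‖x‖) * K ‖x‖ * dir c x * tang i i x := fun i => by
    have := hp.sum_christoffel_rotMap hm hx c i i (F' ‖x‖ * dir i x) (K ‖x‖)
    have e3 : ∀ e, F' ‖x‖ * dir i x * dir e x + K ‖x‖ * tang e i x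
        = pullbackDeriv (modelMetric n h) (rotMap n α) i V e x := fun e => by
      rw [hp.pullbackDeriv_radial hm hx hV (hF _ hr hx.2) i e]; ring
    simp only [e3] at this
    rw [this]
    ring
  have e4 : ∀ i, pullbackDeriv (modelMetric n h) (rotMap n α) i
      (pullbackDeriv (modelMetric n h) (rotMap n α) i V) c x = _ + _ :=
    fun i => congrArg₂ (· + ·) (e1 i) (e2 i)
  simp only [roughLaplacian, sum_euclideanMetric_inv, christoffel_euclideanMetric,
    zero_mul, Finset.sum_const_zero, sub_zero, e4, Finset.sum_add_distrib,
    ← Finset.mul_sum, sum_tang_mul_dir hx.1, sum_tang_self hx.1]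
  rw [sum_pd_radial_endomorphism hx.1 hF' hKd]
  simp only [radialCoeff, hK]
  field_simp
  ring

/-- The curvature term of a radial section along a rotationally symmetric map. -/
theorem RegularProfile.curvatureTrace_radial (hp : RegularProfile α R b) (hm : RegularModel h b)
    (hx : x ∈ puncturedBall n R) {V : Fin n → Coord n → ℝ} {F : ℝ}
    (hV : ∀ c, V c x = F * dir c x) (d : Fin n) :
    curvatureTrace (euclideanMetric n) (modelMetric n h) (rotMap n α) V d x =
      (n - 1) * (h (α ‖x‖) * deriv (deriv h) (α ‖x‖)) / ‖x‖ ^ 2 * F * dir d x := by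
  have hr := norm_pos_iff.mpr hx.1
  have hα := (hp.pos _ hr hx.2).ne'
  have hh := (hm.pos _ (hp.pos _ hr hx.2) (hp.lt _ hr hx.2)).ne'
  have hφ := hp.rotMap_mem hx
  have e1 : ∀ i, ∑ a, ∑ e, ∑ c, curvature (modelMetric n h) d a e c (rotMap n α x)
        * dmap (rotMap n α) a i x * V e x * dmap (rotMap n α) c i x
      = F * ∑ a, ∑ c, dmap (rotMap n α) a i x * dmap (rotMap n α) c i x
        * (h (α ‖x‖) * deriv (deriv h) (α ‖x‖) / α ‖x‖ ^ 2 * tang a c x * dir d x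
        - deriv (deriv h) (α ‖x‖) / h (α ‖x‖) * tang a d x * dir c x) := fun i => by
    rw [Finset.mul_sum]
    -- Since `V` is radial, summing over the second curvature slot leaves only the radial curvature
    -- at the image point.
    refine Finset.sum_congr rfl fun a _ => ?_
    rw [Finset.sum_comm, Finset.mul_sum]
    refine Finset.sum_congr rfl fun c _ => ?_
    have := hm.sum_curvature_mul_dir hφ.1 hφ.2 d a c
    simp only [hp.norm_rotMap hx, hp.dir_rotMap hx, hp.tang_rotMap hx] at this
    rw [← this, Finset.mul_sum, Finset.mul_sum]
    exact Finset.sum_congr rfl fun e _ => by rw [hV]; ring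
  have e2 : ∀ i a c, dmap (rotMap n α) a i x * dmap (rotMap n α) c i x
        * (h (α ‖x‖) * deriv (deriv h) (α ‖x‖) / α ‖x‖ ^ 2 * tang a c x * dir d x
        - deriv (deriv h) (α ‖x‖) / h (α ‖x‖) * tang a d x * dir c x)
      = dmap (rotMap n α) a i x * (h (α ‖x‖) * deriv (deriv h) (α ‖x‖) / α ‖x‖ ^ 2)
          * deriv α ‖x‖ * dir d x * dir i x * (tang a c x * dir c x)
        + dmap (rotMap n α) a i x * (h (α ‖x‖) * deriv (deriv h) (α ‖x‖) / α ‖x‖ ^ 2)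
          * (α ‖x‖ / ‖x‖) * dir d x * (tang a c x * tang c i x)
        - dmap (rotMap n α) a i x * (deriv (deriv h) (α ‖x‖) / h (α ‖x‖))
          * deriv α ‖x‖ * tang a d x * dir i x * (dir c x * dir c x)
        - dmap (rotMap n α) a i x * (deriv (deriv h) (α ‖x‖) / h (α ‖x‖))
          * (α ‖x‖ / ‖x‖) * tang a d x * (dir c x * tang c i x) := fun i a c => by
    rw [hp.dmap_rotMap hx c i]; ring
  have e3 : ∀ i a, dmap (rotMap n α) a i x
          * (h (α ‖x‖) * deriv (deriv h) (α ‖x‖) / α ‖x‖ ^ 2)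
          * (α ‖x‖ / ‖x‖) * dir d x * tang a i x
        - dmap (rotMap n α) a i x * (deriv (deriv h) (α ‖x‖) / h (α ‖x‖))
          * deriv α ‖x‖ * tang a d x * dir i x
      = (h (α ‖x‖) * deriv (deriv h) (α ‖x‖) / α ‖x‖ ^ 2) * (α ‖x‖ / ‖x‖) * dir d x
          * deriv α ‖x‖ * dir i x * (dir a x * tang a i x)
        + (h (α ‖x‖) * deriv (deriv h) (α ‖x‖) / α ‖x‖ ^ 2) * (α ‖x‖ / ‖x‖) ^ 2 * dir d x
          * (tang i a x * tang a i x)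
        - (deriv (deriv h) (α ‖x‖) / h (α ‖x‖)) * deriv α ‖x‖ ^ 2 * (dir i x * dir i x)
          * (dir a x * tang a d x)
        - (deriv (deriv h) (α ‖x‖) / h (α ‖x‖)) * deriv α ‖x‖ * (α ‖x‖ / ‖x‖)
          * dir i x * (tang i a x * tang a d x) := fun i a => by
    rw [hp.dmap_rotMap hx a i, tang_comm i a]; ring
  simp only [curvatureTrace, sum_euclideanMetric_inv, e1, e2, Finset.sum_add_distrib,
    Finset.sum_sub_distrib (s := Finset.univ), ← Finset.mul_sum, sum_tang_mul_dir hx.1,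
    sum_tang_mul_tang hx.1, sum_dir_mul_dir hx.1, sum_dir_mul_tang hx.1, mul_zero, mul_one,
    zero_add, sub_zero]
  simp only [← Finset.sum_sub_distrib (s := Finset.univ)]
  simp only [e3, Finset.sum_add_distrib,
    Finset.sum_sub_distrib (s := Finset.univ), ← Finset.mul_sum,
    sum_tang_mul_tang hx.1, sum_dir_mul_tang hx.1, mul_zero, zero_add, sub_zero]
  -- The part with `h''/h` pairs radial with tangential directions and traces to zero; only the `h
  -- h''` part survives, with the trace of `tang`.
  have e5 : ∀ i, (deriv (deriv h) (α ‖x‖) / h (α ‖x‖)) * deriv α ‖x‖ * (α ‖x‖ / ‖x‖)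
      * dir i x * tang i d x = (deriv (deriv h) (α ‖x‖) / h (α ‖x‖)) * deriv α ‖x‖
      * (α ‖x‖ / ‖x‖) * (dir i x * tang i d x) := fun i => by ring
  simp only [e5, ← Finset.mul_sum, sum_tang_self hx.1, sum_dir_mul_tang hx.1]
  field_simp
  ring

end RotMap

/-! ### Conformality as a first-order equation for the profile, and the vanishing of the bitension
field. -/

section Conformal

variable {n : ℕ} {h α : ℝ → ℝ} {b R : EReal} {x : Coord n}

/-- The pullback of the model metric under a rotationally symmetric map. -/
theorem RegularProfile.pullback_modelMetric (hp : RegularProfile α R b)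
    (hx : x ∈ puncturedBall n R) (i j : Fin n) :
    ∑ a, ∑ e, modelMetric n h (rotMap n α x) a e * dmap (rotMap n α) a i x
        * dmap (rotMap n α) e j x =
      deriv α ‖x‖ ^ 2 * (dir i x * dir j x) + (h (α ‖x‖) / ‖x‖) ^ 2 * tang i j x := by
  have hα := (hp.pos _ (norm_pos_iff.mpr hx.1) hx.2).ne'
  have hφ := hp.rotMap_mem hx
  have e1 : ∀ a e, modelMetric n h (rotMap n α x) a e * dmap (rotMap n α) a i x
        * dmap (rotMap n α) e j x
      = dmap (rotMap n α) a i x * deriv α ‖x‖ * dir a x * dir j x * (dir e x * dir e x)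
        + dmap (rotMap n α) a i x * (α ‖x‖ / ‖x‖) * dir a x * (dir e x * tang e j x)
        + dmap (rotMap n α) a i x * (h (α ‖x‖) / α ‖x‖) ^ 2 * deriv α ‖x‖ * dir j x
          * (tang a e x * dir e x)
        + dmap (rotMap n α) a i x * (h (α ‖x‖) / α ‖x‖) ^ 2 * (α ‖x‖ / ‖x‖)
          * (tang a e x * tang e j x) := fun a e => by
    rw [modelMetric_apply hφ.1, hp.dmap_rotMap hx e j, hp.norm_rotMap hx, hp.dir_rotMap hx,
      hp.dir_rotMap hx, hp.tang_rotMap hx]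
    ring
  have e2 : ∀ a, dmap (rotMap n α) a i x * deriv α ‖x‖ * dir a x * dir j x
        + dmap (rotMap n α) a i x * (h (α ‖x‖) / α ‖x‖) ^ 2 * (α ‖x‖ / ‖x‖) * tang a j x
      = deriv α ‖x‖ ^ 2 * dir i x * dir j x * (dir a x * dir a x)
        + α ‖x‖ / ‖x‖ * deriv α ‖x‖ * dir j x * (dir a x * tang a i x)
        + deriv α ‖x‖ * (h (α ‖x‖) / α ‖x‖) ^ 2 * (α ‖x‖ / ‖x‖) * dir i x
          * (dir a x * tang a j x)
        + (h (α ‖x‖) / α ‖x‖) ^ 2 * (α ‖x‖ / ‖x‖) ^ 2 * (tang i a x * tang a j x) := fun a => by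
    rw [hp.dmap_rotMap hx a i, tang_comm i a]
    ring
  simp only [e1, Finset.sum_add_distrib (ι := Fin n), ← Finset.mul_sum, sum_dir_mul_dir hx.1,
    sum_dir_mul_tang hx.1, sum_tang_mul_dir hx.1, sum_tang_mul_tang hx.1, mul_zero, mul_one,
    add_zero]
  simp only [← Finset.sum_add_distrib]
  simp only [e2, Finset.sum_add_distrib, ← Finset.mul_sum, sum_dir_mul_dir hx.1,
    sum_dir_mul_tang hx.1, sum_tang_mul_tang hx.1]
  field_simp
  ring

theorem single_mem_puncturedBall {t : ℝ} (ht : 0 < t) (htR : (t : EReal) < R) (i : Fin n) :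
    EuclideanSpace.single i t ∈ puncturedBall n R := by
  constructor
  · simpa using ht.ne'
  · change ((‖EuclideanSpace.single i t‖ : ℝ) : EReal) < R
    rwa [PiLp.norm_single, Real.norm_of_nonneg ht.le]

theorem IsModelFunction.regularModel (hmodel : IsModelFunction h b) : RegularModel h b where
  contDiffAt t ht htb := by
    refine hmodel.smooth.contDiffAt (Filter.mem_of_superset (((isOpen_lt continuous_const
      continuous_id).inter (isOpen_lt continuous_coe_real_ereal continuous_const)).mem_nhds
      (show t ∈ {s : ℝ | 0 < s} ∩ {s : ℝ | (s : EReal) < b} from ⟨ht, htb⟩)) ?_)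
    exact fun s hs => ⟨le_of_lt hs.1, hs.2⟩
  pos := hmodel.pos

/-- The bound `α < b` is read off from the norm of the image, and `norm_rotMap` already asks for a
regular profile. The trivial bound `⊤` breaks this circle. -/
theorem IsProfile.regularProfile_top (hα : IsProfile α R) : RegularProfile α R ⊤ where
  contDiffAt t ht htR := hα.smooth.contDiffAt (((isOpen_lt continuous_const
      continuous_id).inter (isOpen_lt continuous_coe_real_ereal continuous_const)).mem_nhds
      (show t ∈ {s : ℝ | 0 < s} ∩ {s : ℝ | (s : EReal) < R} from ⟨ht, htR⟩))
  pos := hα.pos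
  lt _ _ _ := EReal.coe_lt_top _

theorem IsProfile.regularProfile [NeZero n] (hα : IsProfile α R) {V : Set (Coord n)}
    (hV : V ⊆ coordBall n b) (hmaps : Set.MapsTo (rotMap n α) (coordBall n R) V) :
    RegularProfile α R b where
  contDiffAt := hα.regularProfile_top.contDiffAt
  pos := hα.pos
  lt t ht htR := by
    have hx := single_mem_puncturedBall ht htR (0 : Fin n)
    have h1 : ((‖rotMap n α (EuclideanSpace.single 0 t)‖ : ℝ) : EReal) < b := hV (hmaps hx.2)
    rwa [hα.regularProfile_top.norm_rotMap hx, PiLp.norm_single,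
      Real.norm_of_nonneg ht.le] at h1

/-- A conformal rotationally symmetric map satisfies `α'² = (h(α) / r)²`. -/
theorem RegularProfile.deriv_sq_of_conformal (hp : RegularProfile α R b) {V : Set (Coord n)}
    (hconf : IsConformalDiffeo (euclideanMetric n) (modelMetric n h) (rotMap n α)
      (coordBall n R) V) (i j : Fin n) (hij : i ≠ j) {t : ℝ} (ht : 0 < t)
    (htR : (t : EReal) < R) : deriv α t ^ 2 = (h (α t) / t) ^ 2 := by
  have hx := single_mem_puncturedBall ht htR i
  obtain ⟨dil, -, hd⟩ := hconf.conformal _ hx.2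
  -- At the point `t eᵢ` of an axis, `eᵢ` is radial and `eⱼ` tangential. The two diagonal entries
  -- give `α'²` and `(h(α)/t)²`, both equal to `dil²`.
  have h1 := hd i i
  have h2 := hd j j
  rw [hp.pullback_modelMetric hx] at h1 h2
  simp [tang, dir, euclideanMetric, hij.symm, abs_of_pos ht, ht.ne'] at h1 h2
  rw [h1, h2]

/-- The profile of a conformal rotationally symmetric diffeomorphism is increasing. -/
theorem RegularProfile.deriv_eq_of_conformal (hp : RegularProfile α R b) (hm : RegularModel h b)
    (hR : 0 < R) {V : Set (Coord n)}
    (hconf : IsConformalDiffeo (euclideanMetric n) (modelMetric n h) (rotMap n α)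
      (coordBall n R) V) (i j : Fin n) (hij : i ≠ j) {t : ℝ} (ht : 0 < t)
    (htR : (t : EReal) < R) : deriv α t = h (α t) / t := by
  have hpos : ∀ s : ℝ, 0 < s → (s : EReal) < R → 0 < h (α s) / s := fun s hs hsR =>
    div_pos (hm.pos _ (hp.pos _ hs hsR) (hp.lt _ hs hsR)) hs
  have hsq := fun {s : ℝ} => hp.deriv_sq_of_conformal hconf i j hij (t := s)
  suffices 0 < deriv α t from (sq_eq_sq₀ this.le (hpos t ht htR).le).mp (hsq ht htR)
  set S : Set ℝ := {s : ℝ | 0 < s ∧ (s : EReal) < R} with hS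
  have hSconn : S.OrdConnected := ⟨fun p hp' q hq s hs =>
    ⟨hp'.1.trans_le hs.1, (EReal.coe_le_coe_iff.mpr hs.2).trans_lt hq.2⟩⟩
  have hSopen : IsOpen S := (isOpen_lt continuous_const
      continuous_id).inter (isOpen_lt continuous_coe_real_ereal continuous_const)
  have hder : ∀ s ∈ S, HasDerivAt α (deriv α s) s := fun s hs =>
    hasDerivAt_of_contDiffAt (hp.contDiffAt s hs.1 hs.2)
  -- The square of `α'` is positive, so `α'` never vanishes, and by Darboux's theorem it has
  -- constant sign on the interval.
  rcases hasDerivWithinAt_forall_lt_or_forall_gt_of_forall_ne hSconn.convex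
    (fun s hs => (hder s hs).hasDerivWithinAt) (m := 0) (fun s hs h0 => by
      have := hsq hs.1 hs.2
      have h2 := pow_pos (hpos s hs.1 hs.2) 2
      rw [← this, h0] at h2
      norm_num at h2) with hneg | hpos'
  · exfalso
    have hanti : StrictAntiOn α S := strictAntiOn_of_deriv_neg hSconn.convex
      (fun s hs => (hder s hs).continuousAt.continuousWithinAt)
      (fun s hs => hneg s (interior_subset hs))
    have h0 : (0 : Coord n) ∈ coordBall n R := by
      change ((‖(0 : Coord n)‖ : ℝ) : EReal) < R
      simpa using hR
    have hcont : ContinuousAt (rotMap n α) 0 :=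
      (hconf.smooth.contDiffAt ((isOpen_coordBall R).mem_nhds h0)).continuousAt
    have hline : Filter.Tendsto (fun s : ℝ => (EuclideanSpace.single i s : Coord n)) (nhds 0)
        (nhds 0) := by
      have : (fun s : ℝ => (EuclideanSpace.single i s : Coord n))
          = fun s => s • EuclideanSpace.single i (1 : ℝ) := by
        funext s; ext k; simp
      rw [this]
      exact Continuous.tendsto' (by fun_prop) _ _ (zero_smul ℝ _)
    -- Continuity of the map at the pole, restricted to an axis and combined with the norm, forces
    -- `α → 0`. A decreasing `α` would then be nonpositive.
    have hlim : Filter.Tendsto α (nhdsWithin 0 (Set.Ioi 0)) (nhds 0) := by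
      have h1 := (hcont.norm.tendsto.comp hline).mono_left (nhdsWithin_le_nhds (s := Set.Ioi 0))
      rw [show ‖rotMap n α 0‖ = 0 by simp [rotMap]] at h1
      refine h1.congr' ?_
      filter_upwards [Ioo_mem_nhdsGT ht] with s hs
      have hx := single_mem_puncturedBall hs.1
        ((EReal.coe_le_coe_iff.mpr hs.2.le).trans_lt htR) i
      have h2 := hp.norm_rotMap hx
      rw [Function.comp_apply, h2, PiLp.norm_single, Real.norm_of_nonneg hs.1.le]
    have hle : α t ≤ 0 := by
      refine ge_of_tendsto hlim ?_
      filter_upwards [Ioo_mem_nhdsGT ht] with s hs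
      exact (hanti ⟨hs.1, (EReal.coe_le_coe_iff.mpr hs.2.le).trans_lt htR⟩ ⟨ht, htR⟩ hs.2).le
    exact absurd (hp.pos t ht htR) hle.not_gt
  · exact hpos' t ⟨ht, htR⟩

/-- The bitension field of a rotationally symmetric map solving `α' = h(α) / r` vanishes away from
the pole if the four-dimensional model satisfies the third order equation. -/
theorem RegularProfile.bitension_eq_zero {x : Coord 4} (hp : RegularProfile α R b)
    (hm : RegularModel h b)
    (hode : ∀ t : ℝ, 0 < t → (t : EReal) < b →
      h t ^ 2 * iteratedDeriv 3 h t + deriv h t * (2 + h t * iteratedDeriv 2 h t)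
        - 2 * deriv h t ^ 3 = 0)
    (hα' : ∀ t : ℝ, 0 < t → (t : EReal) < R → deriv α t = h (α t) / t)
    (hx : x ∈ puncturedBall 4 R) (c : Fin 4) :
    bitension (euclideanMetric 4) (modelMetric 4 h) (rotMap 4 α) c x = 0 := by
  have hdα : ∀ t : ℝ, 0 < t → (t : EReal) < R → HasDerivAt α (h (α t) / t) t :=
    fun t ht htR => hα' t ht htR ▸ hasDerivAt_of_contDiffAt (hp.contDiffAt t ht htR)
  have hs := fun (t : ℝ) (ht : 0 < t) (htR : (t : EReal) < R) =>
    hm.contDiffAt _ (hp.pos t ht htR) (hp.lt t ht htR)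
  have d0 : ∀ t : ℝ, 0 < t → (t : EReal) < R →
      HasDerivAt (fun t => h (α t)) (deriv h (α t) * (h (α t) / t)) t := fun t ht htR =>
    (hasDerivAt_of_contDiffAt (hs t ht htR)).comp t (hdα t ht htR)
  have d1 : ∀ t : ℝ, 0 < t → (t : EReal) < R →
      HasDerivAt (fun t => deriv h (α t)) (deriv (deriv h) (α t) * (h (α t) / t)) t :=
    fun t ht htR => (hasDerivAt_of_contDiffAt (contDiffAt_deriv (hs t ht htR))).comp t
      (hdα t ht htR)
  have d2 : ∀ t : ℝ, 0 < t → (t : EReal) < R → HasDerivAt (fun t => deriv (deriv h) (α t))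
      (deriv (deriv (deriv h)) (α t) * (h (α t) / t)) t := fun t ht htR =>
    (hasDerivAt_of_contDiffAt (contDiffAt_deriv (contDiffAt_deriv (hs t ht htR)))).comp t
      (hdα t ht htR)
  -- With `α' = h/r` one has `α'' = (h h' - h)/r²`, and the tension coefficient is `(h h' - h + 3 h
  -- - 3 h h')/r²`.
  set F : ℝ → ℝ := fun t => 2 * h (α t) * (1 - deriv h (α t)) / t ^ 2 with hFdef
  set F' : ℝ → ℝ := fun t => 2 * h (α t) * (deriv h (α t) * (1 - deriv h (α t))
    - h (α t) * deriv (deriv h) (α t) - 2 * (1 - deriv h (α t))) / t ^ 3 with hF'def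
  have hF : ∀ t : ℝ, 0 < t → (t : EReal) < R → HasDerivAt F (F' t) t := fun t ht htR => by
    have := (((d0 t ht htR).const_mul 2).fun_mul ((d1 t ht htR).const_sub 1)).fun_div
      ((hasDerivAt_id t).fun_pow 2) (pow_ne_zero 2 ht.ne')
    refine this.congr_deriv ?_
    simp only [hF'def, id, Nat.add_one_sub_one, pow_one, Nat.cast_ofNat]
    field_simp
    ring
  have hV : ∀ c, ∀ y ∈ puncturedBall 4 R,
      tension (euclideanMetric 4) (modelMetric 4 h) (rotMap 4 α) c y = F ‖y‖ * dir c y := by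
    intro c y hy
    have hr := norm_pos_iff.mpr hy.1
    have e1 : deriv (deriv α) ‖y‖
        = (deriv h (α ‖y‖) * (h (α ‖y‖) / ‖y‖) * ‖y‖ - h (α ‖y‖) * 1) / ‖y‖ ^ 2 := by
      have : deriv α =ᶠ[nhds ‖y‖] fun t => h (α t) / t := by
        have hO : IsOpen {s : ℝ | 0 < s ∧ (s : EReal) < R} := (isOpen_lt continuous_const
          continuous_id).inter (isOpen_lt continuous_coe_real_ereal continuous_const)
        exact Filter.eventuallyEq_of_mem (hO.mem_nhds ⟨hr, hy.2⟩) fun s hs => hα' s hs.1 hs.2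
      rw [this.deriv_eq]
      exact ((d0 _ hr hy.2).fun_div (hasDerivAt_id _) hr.ne').deriv
    rw [hp.tension_rotMap hm hy, e1, hα' _ hr hy.2]
    simp only [hFdef]
    push_cast
    field_simp
    ring
  have hr := norm_pos_iff.mpr hx.1
  have q0 := d0 _ hr hx.2
  have q1 := d1 _ hr hx.2
  have hF' : HasDerivAt F' _ ‖x‖ := ((q0.const_mul 2).fun_mul
    (((q1.fun_mul (q1.const_sub 1)).fun_sub (q0.fun_mul (d2 _ hr hx.2))).fun_sub
      ((q1.const_sub 1).const_mul 2))).fun_div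
      ((hasDerivAt_id ‖x‖).fun_pow 3) (pow_ne_zero 3 hr.ne')
  have ode := hode _ (hp.pos _ hr hx.2) (hp.lt _ hr hx.2)
  simp only [iteratedDeriv_succ, iteratedDeriv_zero] at ode
  rw [bitension, hp.roughLaplacian_radial hm hx hV hF hF',
    hp.curvatureTrace_radial hm hx fun c => hV c x hx]
  simp only [hFdef, hF'def, id, Nat.add_one_sub_one, Nat.cast_ofNat]
  field_simp
  linear_combination (-2 * h (α ‖x‖) * dir c x) * ode

end Conformal

end BiharmonicModels

end

theorem mainTheorem2 (h : ℝ → ℝ) (b : EReal)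
    (hmodel : BiharmonicModels.IsModelFunction h b)
    (hode : ∀ t : ℝ, 0 < t → (t : EReal) < b →
      h t ^ 2 * iteratedDeriv 3 h t + deriv h t * (2 + h t * iteratedDeriv 2 h t)
        - 2 * deriv h t ^ 3 = 0)
    (R : EReal) (hR : 0 < R) (α : ℝ → ℝ) (hα : BiharmonicModels.IsProfile α R)
    (V : Set (BiharmonicModels.Coord 4)) (hVopen : IsOpen V)
    (hV : V ⊆ BiharmonicModels.coordBall 4 b)
    (hconf : BiharmonicModels.IsConformalDiffeo (BiharmonicModels.euclideanMetric 4)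
      (BiharmonicModels.modelMetric 4 h) (BiharmonicModels.rotMap 4 α)
      (BiharmonicModels.coordBall 4 R) V) :
    BiharmonicModels.IsBiharmonicOn (BiharmonicModels.euclideanMetric 4)
      (BiharmonicModels.modelMetric 4 h) (BiharmonicModels.rotMap 4 α)
      (BiharmonicModels.coordBall 4 R) := by
  have hm := hmodel.regularModel
  have hp := hα.regularProfile hV hconf.bijOn.mapsTo
  refine ⟨hconf.smooth, fun x hx c => ?_⟩
  -- The radial formulas require `x ≠ 0`; at the pole the antipodal symmetry takes over.
  by_cases h0 : x = 0
  · rw [h0]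
    exact BiharmonicModels.bitension_zero (fun _ => rfl)
      BiharmonicModels.modelMetric_neg BiharmonicModels.rotMap_neg c
  · exact hp.bitension_eq_zero hm hode
      (fun t ht htR => hp.deriv_eq_of_conformal hm hR hconf 0 1 (by decide) ht htR) ⟨h0, hx⟩ c
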